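/- **Model.** There are $J$ binary items and independent examinees $i=1,2,\dots$. Examinee $i$ has latent person parameters $(\theta_i,\tau_i)\sim N(0,\Sigma)$ with $\Sigma=\begin{pmatrix}1&\sigma_{\theta\tau}\\ \sigma_{\theta\tau}&\sigma_\tau^2\end{pmatrix}$ positive definite. Let $\lambda=(a_1,\dots,a_J,b_1,\dots,b_J,\zeta_1,\dots,\zeta_J)\in D=(0,\infty)^J\times\mathbb R^J\times\mathbb R^J$ be the item parameters, and let each of $F$ and $G$ be the distribution function of the standard normal or of the standard logistic distribution. Given $(\theta_i,\tau_i)$, the responses $Y_{ij}\in\{0,1\}$ are independent over $j$ with $P(Y_{ij}=1)=p_{ij}=F(a_j(\theta_i-b_j))$, and the missingness indicators $R_{ij}$ ($R_{ij}=1$ if $Y_{ij}$ is not observed) are generated one after the other with $$P(R_{ij}=1\mid Y_{i\cdot},R_{i1},\dots,R_{i,j-1},\theta_i,\tau_i)=\pi_{ij}=G\Big(\gamma_0-\tau_i+\zeta_j+\gamma_1\sum_{h=2}^{j-1}R_{ih}+\gamma_2Y_{ij}\Big).$$ The real numbers $\gamma_0,\gamma_1,\gamma_2,\sigma_{\theta\tau},\sigma^2_\tau$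 are known. The marginal probability of the observed data of one examinee is $$P(y^{\rm obs},r\mid\lambda)=\sum_{y^{\rm mis}}\iint\prod_{j=1}^J p_j^{y_j}(1-p_j)^{1-y_j}\,\pi_j^{r_j}(1-\pi_j)^{1-r_j}\;p(\theta,\tau\mid 0,\Sigma)\,d\theta\,d\tau ,$$ where $y^{\rm mis}$ runs over all values of the responses with $r_j=1$. A marginal maximum likelihood (MML) estimate over a set $\Theta\subseteq D$ from the data of $N$ examinees is a maximizer over $\lambda\in\Theta$ of $\log\prod_{i=1}^N P(Y_i^{\rm obs},R_i\mid\lambda)$. The Fisher information $I(\lambda_0)$ is the $3J\times3J$ matrix with entries $\mathrm E_{\lambda_0}\big[\partial_k\log P(Y^{\rm obs},R\mid\lambda)\,\partial_m\log P(Y^{\rm obs},R\mid\lambda)\big]\big|_{\lambda=\lambda_0}$. **Theorem.** Let $\Theta\subseteq D$ (for example $\Theta=D$, or a compact box in $D$), let the true parameter $\lambda_0$ be an interior point of $\Theta$, and let $I(\lambda_0)$ be invertible. Let $\hat\lambda_N=(\hat a,\hat b,\hat\zeta)$ be random vectors such that, with probability tending to $1$ as $N\to\infty$, $\hat\lambda_N$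 is an MML estimate over $\Theta$ from the data of the first $N$ examinees. If $\hat\lambda_N$ is consistent, that is, $\hat\lambda_N\to\lambda_0$ in probability, then $$\sqrt N\,(\hat\lambda_N-\lambda_0)\ \xrightarrow{d}\ N\big(0,\,I(\lambda_0)^{-1}\big)\qquad(N\to\infty).$$ -/

import Mathlib

open MeasureTheory ProbabilityTheory Filter Topology

namespace MissingIRT

noncomputable section

/-- The two admissible link functions. -/
inductive Link
  | probit
  | logit

/-- The distribution function attached to a link: standard normal or standard logistic. -/
def Link.toFun : Link → ℝ → ℝ
  | .probit => fun x => cdf (gaussianReal 0 1) x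
  | .logit => fun x => Real.sigmoid x

/-- The known ingredients of the model: the link `F` of the item response part, the link `G` of
the missingness part, the coefficients `γ₀, γ₁, γ₂`, the covariance `σ_θτ` of ability and person
missing parameter, and the variance `σ²_τ` of the person missing parameter. -/
structure Known where
  F : Link
  G : Link
  γ₀ : ℝ
  γ₁ : ℝ
  γ₂ : ℝ
  σθτ : ℝ
  σττ : ℝ

/-- The vector `λ = (a₁,…,a_J, b₁,…,b_J, ζ₁,…,ζ_J)` of all item parameters; the first index
`0, 1, 2` selects `a`, `b`, `ζ`, the second one the item. -/
abbrev ItemParams (J : ℕ) : Type := EuclideanSpace ℝ (Fin 3 × Fin J)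

variable {J : ℕ}

/-- Discrimination `a_j`. -/
def disc (l : ItemParams J) (j : Fin J) : ℝ := l (0, j)

/-- Difficulty `b_j`. -/
def diff (l : ItemParams J) (j : Fin J) : ℝ := l (1, j)

/-- Item missing parameter `ζ_j`. -/
def zeta (l : ItemParams J) (j : Fin J) : ℝ := l (2, j)

/-- The parameter space `D`: all discriminations are positive. -/
def paramSpace (J : ℕ) : Set (ItemParams J) := {l | ∀ j, 0 < disc l j}

/-- The number `0` or `1` encoded by a Boolean. -/
def ind (x : Bool) : ℝ := if x then 1 else 0

/-- Probability that a Bernoulli variable with success probability `p` takes the value `x`. -/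
def bern (p : ℝ) (x : Bool) : ℝ := if x then p else 1 - p

/-- `p_j = P(Y_j = 1 | θ) = F(a_j (θ - b_j))`. -/
def respProb (K : Known) (l : ItemParams J) (θ : ℝ) (j : Fin J) : ℝ :=
  K.F.toFun (disc l j * (θ - diff l j))

/-- `π_j = P(R_j = 1 | τ, R_1, …, R_{j-1}, Y_j)
= G(γ₀ - τ + ζ_j + γ₁ ∑_{h=2}^{j-1} R_h + γ₂ Y_j)`, where `R_j = 1` means that the response to
item `j` is missing. As items are numbered from `0` here, the item `h` runs over `0 < h < j`. -/
def missProb (K : Known) (l : ItemParams J) (τ : ℝ) (y r : Fin J → Bool) (j : Fin J) : ℝ :=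
  K.G.toFun (K.γ₀ - τ + zeta l j
    + K.γ₁ * (∑ h : Fin J, if 0 < h.val ∧ h.val < j.val then ind (r h) else 0)
    + K.γ₂ * ind (y j))

/-- Conditional probability of the response pattern `y` and the missingness pattern `r` of one
examinee, given the person parameters `θ` and `τ`. -/
def condLik (K : Known) (l : ItemParams J) (y r : Fin J → Bool) (θ τ : ℝ) : ℝ :=
  ∏ j, bern (respProb K l θ j) (y j) * bern (missProb K l τ y r j) (r j)

/-- The covariance matrix of `(θ, τ)`; the variance of `θ` is fixed to `1`. -/
def latentCov (K : Known) : Matrix (Fin 2) (Fin 2) ℝ :=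
  !![1, K.σθτ; K.σθτ, K.σττ]

/-- The distribution of `(θ, τ)`: bivariate normal, with mean zero. -/
def latentLaw (K : Known) : Measure (EuclideanSpace ℝ (Fin 2)) :=
  multivariateGaussian 0 (latentCov K)

/-- The probability `P(Y = y, R = r | λ)` that an examinee with random person parameters has
the (partly unobserved) response pattern `y` and the missingness pattern `r`. -/
def completeProb (K : Known) (l : ItemParams J) (y r : Fin J → Bool) : ℝ :=
  ∫ u, condLik K l y r (u 0) (u 1) ∂(latentLaw K)

open Classical in
/-- The marginal probability `P(Y^obs, R | λ)` of the observed data of an examinee: the sum of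
`P(Y = y', R = r | λ)` over all `y'` that agree with `y` on the observed items (`r j = 0`). It
depends on `y` only through its observed part. -/
def obsProb (K : Known) (l : ItemParams J) (y r : Fin J → Bool) : ℝ :=
  ∑ y' : Fin J → Bool, if ∀ j, r j = false → y' j = y j then completeProb K l y' r else 0

/-- The marginal log-likelihood `log ∏_{i<N} P(Y_i^obs, R_i | λ)` of the first `N` examinees. -/
def logLik (K : Known) (N : ℕ) (y r : ℕ → Fin J → Bool) (l : ItemParams J) : ℝ :=
  Real.log (∏ i ∈ Finset.range N, obsProb K l (y i) (r i))

/-- `l` is a marginal maximum likelihood (MML) estimate over the parameter set `Θ` from the data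
of the first `N` examinees. -/
def IsMML (K : Known) (Θ : Set (ItemParams J)) (N : ℕ) (y r : ℕ → Fin J → Bool)
    (l : ItemParams J) : Prop :=
  l ∈ Θ ∧ IsMaxOn (logLik K N y r) Θ l

/-- `(Y i, R i)`, `i = 0, 1, 2, …`, are the response and missingness patterns of independent
examinees that follow the model with item parameters `l`. -/
structure IsSample {Ω : Type*} [MeasurableSpace Ω] (μ : Measure Ω) (K : Known)
    (l : ItemParams J) (Y R : ℕ → Ω → Fin J → Bool) : Prop where
  measurable_Y : ∀ i, Measurable (Y i)
  measurable_R : ∀ i, Measurable (R i)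
  indep : iIndepFun (fun i ω => (Y i ω, R i ω)) μ
  law : ∀ i y r, μ {ω | Y i ω = y ∧ R i ω = r} = ENNReal.ofReal (completeProb K l y r)

/-- The partial derivative at `l` of `log P(Y^obs, R | λ)` with respect to the coordinate `k`
of `λ`. -/
def score (K : Known) (l : ItemParams J) (y r : Fin J → Bool) (k : Fin 3 × Fin J) : ℝ :=
  fderiv ℝ (fun l' => Real.log (obsProb K l' y r)) l (EuclideanSpace.single k 1)

/-- The Fisher information matrix of the observed data of one examinee at `l`: the entry
`(k, m)` is the expectation, under the model with parameter `l`, of the product of the scores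
for the coordinates `k` and `m`. -/
def fisherInfo (K : Known) (l : ItemParams J) : Matrix (Fin 3 × Fin J) (Fin 3 × Fin J) ℝ :=
  Matrix.of fun k m =>
    ∑ y : Fin J → Bool, ∑ r : Fin J → Bool,
      completeProb K l y r * (score K l y r k * score K l y r m)

end

end MissingIRT

namespace MissingIRT

/-! The data of one examinee take finitely many values `x = (y, r)`, so the likelihood equation
depends on the sample only through the counts `m x`. Let `q x l` be the probability of `x` and `A x
l` the observed-data score. An interior maximizer solves `∑ m x • A x l = 0`, whereas `∑ q x l • A x
l = 0` holds at every `l`. Combining the two gives `∑ (m x - N * q x l₀) • A x l = N • ∑ (q x l - q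
x l₀) • A x l`. The factors `q x l - q x l₀` vanish at `l₀`, so the sum on the right is
differentiable there even though `A` is merely continuous; its derivative is the Fisher information.
No second derivative of the likelihood is needed. Hence `N • (l - l₀)` equals the inverse
information applied to `∑ m x • A x l₀`, up to an arbitrarily small multiple of `∑ |m x - N * q x
l₀|` (`eventually_norm_smul_sub_le`). The latter is `O_P(√N)` by Chebyshev, and the central limit
theorem for the scores at `l₀` together with Slutsky's lemma concludes
(`tendstoInDistribution_of_score_eq_zero`).

The model has to supply continuous differentiability (`contDiff_completeProb`, by domination under
the Gaussian integral) and the mean-zero and information identities, both consequences of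
`sum_completeProb_mul_inner_scoreVec`. -/

/-! ### Link functions and Bernoulli factors -/

theorem cdf_gaussianReal_eq_integral (x : ℝ) :
    cdf (gaussianReal 0 1) x = ∫ t in Set.Iic x, gaussianPDFReal 0 1 t := by
  rw [cdf_eq_real, measureReal_def, gaussianReal_apply_eq_integral _ one_ne_zero,
    ENNReal.toReal_ofReal]
  exact setIntegral_nonneg measurableSet_Iic fun t _ => gaussianPDFReal_nonneg _ _ _

theorem continuous_gaussianPDFReal : Continuous (gaussianPDFReal 0 1) := by
  rw [gaussianPDFReal_def]
  fun_prop

theorem hasDerivAt_cdf_gaussianReal (x : ℝ) :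
    HasDerivAt (fun x => cdf (gaussianReal 0 1) x) (gaussianPDFReal 0 1 x) x := by
  have hint : Integrable (gaussianPDFReal 0 1) := integrable_gaussianPDFReal 0 1
  have h := (intervalIntegral.integral_hasDerivAt_right (a := 0) (b := x)
    hint.intervalIntegrable
    (continuous_gaussianPDFReal.stronglyMeasurableAtFilter _ _)
    continuous_gaussianPDFReal.continuousAt).const_add (cdf (gaussianReal 0 1) 0)
  refine h.congr_of_eventuallyEq (Eventually.of_forall fun y => ?_)
  simp only
  rw [← intervalIntegral.integral_Iic_sub_Iic hint.integrableOn hint.integrableOn,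
    cdf_gaussianReal_eq_integral, cdf_gaussianReal_eq_integral]
  ring

theorem gaussianPDFReal_le_one (x : ℝ) : gaussianPDFReal 0 1 x ≤ 1 := by
  simp only [gaussianPDFReal_def]
  refine mul_le_one₀ (inv_le_one_of_one_le₀ ?_) (Real.exp_pos _).le (Real.exp_le_one_iff.2 ?_)
  · rw [Real.one_le_sqrt]
    have := Real.pi_gt_three
    norm_num
    linarith
  · have : 0 ≤ (x - 0) ^ 2 / (2 * ((1 : NNReal) : ℝ)) := by positivity
    rw [neg_div]
    linarith

theorem cdf_gaussianReal_strictMono : StrictMono (cdf (gaussianReal 0 1)) :=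
  strictMono_of_hasDerivAt_pos (f' := gaussianPDFReal 0 1) hasDerivAt_cdf_gaussianReal
    fun _ => gaussianPDFReal_pos _ _ _ one_ne_zero

theorem Link.toFun_pos (L : Link) (x : ℝ) : 0 < L.toFun x := by
  cases L with
  | probit =>
    exact (cdf_nonneg _ (x - 1)).trans_lt (cdf_gaussianReal_strictMono (by linarith))
  | logit => exact Real.sigmoid_pos x

theorem Link.toFun_lt_one (L : Link) (x : ℝ) : L.toFun x < 1 := by
  cases L with
  | probit =>
    exact (cdf_gaussianReal_strictMono (by linarith : x < x + 1)).trans_le (cdf_le_one _ _)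
  | logit => exact Real.sigmoid_lt_one x

theorem Link.contDiff (L : Link) : ContDiff ℝ 1 L.toFun := by
  cases L with
  | probit =>
    refine contDiff_one_iff_deriv.2 ⟨fun x => (hasDerivAt_cdf_gaussianReal x).differentiableAt, ?_⟩
    have : deriv (Link.probit.toFun) = gaussianPDFReal 0 1 :=
      funext fun x => (hasDerivAt_cdf_gaussianReal x).deriv
    rw [this]
    exact continuous_gaussianPDFReal
  | logit => exact contDiff_sigmoid.of_le le_top

/-- A bound uniform in `x` is what lets the derivative of the conditional likelihood be dominated
over all person parameters. -/
theorem Link.norm_deriv_le_one (L : Link) (x : ℝ) : ‖deriv L.toFun x‖ ≤ 1 := by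
  cases L with
  | probit =>
    have : deriv Link.probit.toFun x = gaussianPDFReal 0 1 x :=
      (hasDerivAt_cdf_gaussianReal x).deriv
    rw [this, Real.norm_of_nonneg (gaussianPDFReal_nonneg _ _ _)]
    exact gaussianPDFReal_le_one x
  | logit =>
    have : deriv Link.logit.toFun x = Real.sigmoid x * (1 - Real.sigmoid x) :=
      congrFun Real.deriv_sigmoid x
    have h0 := Real.sigmoid_pos x
    have h1 := Real.sigmoid_lt_one x
    rw [this, Real.norm_of_nonneg (mul_nonneg h0.le (by linarith))]
    nlinarith

theorem bern_pos {p : ℝ} (h0 : 0 < p) (h1 : p < 1) (x : Bool) : 0 < bern p x := by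
  cases x <;> simp [bern, h0, h1]

theorem bern_le_one {p : ℝ} (h0 : 0 < p) (h1 : p < 1) (x : Bool) : bern p x ≤ 1 := by
  cases x <;> simp [bern, h0.le, h1.le]

theorem ContDiff.bern {E : Type*} [NormedAddCommGroup E] [NormedSpace ℝ E] {f : E → ℝ}
    (hf : ContDiff ℝ 1 f) (x : Bool) : ContDiff ℝ 1 fun v => bern (f v) x := by
  cases x
  · simpa [MissingIRT.bern] using contDiff_const.sub hf
  · simpa [MissingIRT.bern] using hf

theorem norm_fderiv_bern_link_le {E : Type*} [NormedAddCommGroup E] [NormedSpace ℝ E]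
    (L : Link) (x : Bool) {h : E → ℝ} {h' : E →L[ℝ] ℝ} {v : E} (hh : HasFDerivAt h h' v) :
    ‖fderiv ℝ (fun v => bern (L.toFun (h v)) x) v‖ ≤ ‖h'‖ := by
  have hL : HasDerivAt L.toFun (deriv L.toFun (h v)) (h v) :=
    (L.contDiff.differentiable (by norm_num) _).hasDerivAt
  have h1 : HasFDerivAt (fun v => L.toFun (h v)) (deriv L.toFun (h v) • h') v :=
    hL.comp_hasFDerivAt v hh
  have h2 : ‖deriv L.toFun (h v) • h'‖ ≤ ‖h'‖ := by
    rw [norm_smul]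
    exact mul_le_of_le_one_left (norm_nonneg _) (L.norm_deriv_le_one _)
  cases x
  · have : fderiv ℝ (fun v => bern (L.toFun (h v)) false) v = -(deriv L.toFun (h v) • h') := by
      simpa [bern] using (h1.const_sub 1).fderiv
    rw [this, norm_neg]
    exact h2
  · have : fderiv ℝ (fun v => bern (L.toFun (h v)) true) v = deriv L.toFun (h v) • h' := by
      simpa [bern] using h1.fderiv
    rw [this]
    exact h2

/-- The derivative of a product of functions bounded by `1` is bounded by the sum of the bounds of
the derivatives of the factors. -/
theorem norm_fderiv_prod_le {E ι : Type*} [NormedAddCommGroup E] [NormedSpace ℝ E]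
    (s : Finset ι) {f : ι → E → ℝ} {v : E} (hd : ∀ i ∈ s, DifferentiableAt ℝ (f i) v)
    (h1 : ∀ i ∈ s, |f i v| ≤ 1) :
    ‖fderiv ℝ (fun v => ∏ i ∈ s, f i v) v‖ ≤ ∑ i ∈ s, ‖fderiv ℝ (f i) v‖ := by
  classical
  rw [fderiv_finsetProd hd]
  refine (norm_sum_le _ _).trans (Finset.sum_le_sum fun i _ => ?_)
  rw [norm_smul, norm_prod]
  refine mul_le_of_le_one_left (norm_nonneg _) (Finset.prod_le_one (fun _ _ => norm_nonneg _) ?_)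
  exact fun j hj => h1 j (Finset.mem_of_mem_erase hj)

theorem sum_bern (p : ℝ) : ∑ x : Bool, bern p x = 1 := by
  simp [bern]

/-- Sequentially generated binary variables: if the success probability of the `j`-th one depends
only on the values before `j`, then the probabilities of all patterns add up to `1`. -/
theorem sum_prod_bern {n : ℕ} (f : Fin n → (Fin n → Bool) → ℝ)
    (hf : ∀ j r r', (∀ h, h < j → r h = r' h) → f j r = f j r') :
    ∑ r : Fin n → Bool, ∏ j, bern (f j r) (r j) = 1 := by
  induction n with
  | zero => simp
  | succ n ih =>
    -- The appended `false` is a dummy: no probability with index up to `Fin.last n` looks at the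
    -- last value.
    have key := ih (fun j r => f j.castSucc (Fin.snoc r false)) fun j r r' hr => by
      refine hf _ _ _ fun h hh => ?_
      have hn : (h : ℕ) < n := lt_trans (Fin.lt_def.1 hh) j.isLt
      have : h = Fin.castSucc ⟨h, hn⟩ := rfl
      rw [this, Fin.snoc_castSucc, Fin.snoc_castSucc]
      exact hr _ hh
    rw [← (Fin.snocEquiv fun _ => Bool).sum_comp, Fintype.sum_prod_type_right, ← key]
    refine Finset.sum_congr rfl fun r _ => ?_
    have hc : ∀ (b : Bool) (j : Fin n), f j.castSucc (Fin.snoc r b) =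
        f j.castSucc (Fin.snoc r false) := fun b j => hf _ _ _ fun h hh => by
      have hn : (h : ℕ) < n := lt_trans (Fin.lt_def.1 hh) j.isLt
      have : h = Fin.castSucc ⟨h, hn⟩ := rfl
      rw [this, Fin.snoc_castSucc, Fin.snoc_castSucc]
    have hl : ∀ b : Bool, f (Fin.last n) (Fin.snoc r b) =
        f (Fin.last n) (Fin.snoc r false) := fun b => hf _ _ _ fun h hh => by
      have hn : (h : ℕ) < n := Fin.lt_def.1 hh
      have : h = Fin.castSucc ⟨h, hn⟩ := rfl
      rw [this, Fin.snoc_castSucc, Fin.snoc_castSucc]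
    change ∑ b : Bool, ∏ j, bern (f j (Fin.snoc r b)) ((Fin.snoc r b : Fin (n + 1) → Bool) j) = _
    simp only [Fin.prod_univ_castSucc, Fin.snoc_castSucc, Fin.snoc_last, hc, hl]
    rw [← Finset.mul_sum, sum_bern, mul_one]

theorem measurable_fderiv_left {U E : Type*} [TopologicalSpace U] [MeasurableSpace U]
    [OpensMeasurableSpace U] [NormedAddCommGroup E] [NormedSpace ℝ E] [LocallyCompactSpace E]
    [MeasurableSpace E] [OpensMeasurableSpace E] {f : U → E → ℝ}
    (hf : Continuous (Function.uncurry f)) (v : E) : Measurable fun u => fderiv ℝ (f u) v :=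
  (measurable_fderiv_with_param ℝ hf).comp (measurable_id.prodMk measurable_const)

variable {J : ℕ}

/-! ### Smoothness of the complete-data probabilities -/

section

variable (K : Known) (y r : Fin J → Bool)

theorem condLik_pos (l : ItemParams J) (θ τ : ℝ) : 0 < condLik K l y r θ τ :=
  Finset.prod_pos fun _ _ => mul_pos (bern_pos (K.F.toFun_pos _) (K.F.toFun_lt_one _) _)
    (bern_pos (K.G.toFun_pos _) (K.G.toFun_lt_one _) _)

theorem condLik_le_one (l : ItemParams J) (θ τ : ℝ) : condLik K l y r θ τ ≤ 1 := by
  have h1 := fun j => bern_pos (K.F.toFun_pos (disc l j * (θ - diff l j))) (K.F.toFun_lt_one _) (y j)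
  have h2 := fun j => bern_pos (K.G.toFun_pos (K.γ₀ - τ + zeta l j
    + K.γ₁ * (∑ h : Fin J, if 0 < h.val ∧ h.val < j.val then ind (r h) else 0)
    + K.γ₂ * ind (y j))) (K.G.toFun_lt_one _) (r j)
  exact Finset.prod_le_one (fun j _ => (mul_pos (h1 j) (h2 j)).le) fun j _ =>
    mul_le_one₀ (bern_le_one (K.F.toFun_pos _) (K.F.toFun_lt_one _) _) (h2 j).le
      (bern_le_one (K.G.toFun_pos _) (K.G.toFun_lt_one _) _)

theorem contDiff_apply_itemParams (i : Fin 3 × Fin J) :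
    ContDiff ℝ 1 fun l : ItemParams J => l i :=
  (EuclideanSpace.proj (𝕜 := ℝ) i).contDiff

theorem contDiff_condLik :
    ContDiff ℝ 1 fun p : EuclideanSpace ℝ (Fin 2) × ItemParams J =>
      condLik K p.2 y r (p.1 0) (p.1 1) := by
  have hθ : ∀ i : Fin 2, ContDiff ℝ 1 fun p : EuclideanSpace ℝ (Fin 2) × ItemParams J => p.1 i :=
    fun i => (EuclideanSpace.proj (𝕜 := ℝ) i).contDiff.comp contDiff_fst
  have hl : ∀ i, ContDiff ℝ 1 fun p : EuclideanSpace ℝ (Fin 2) × ItemParams J => p.2 i :=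
    fun i => (contDiff_apply_itemParams i).comp contDiff_snd
  refine contDiff_prod fun j _ => ContDiff.mul ?_ ?_
  · exact ContDiff.bern (K.F.contDiff.comp ((hl (0, j)).mul ((hθ 0).sub (hl (1, j))))) _
  · exact ContDiff.bern (K.G.contDiff.comp
      ((((contDiff_const.sub (hθ 1)).add (hl (2, j))).add contDiff_const).add contDiff_const)) _

theorem contDiff_condLik_right (u : EuclideanSpace ℝ (Fin 2)) :
    ContDiff ℝ 1 fun l : ItemParams J => condLik K l y r (u 0) (u 1) :=
  (contDiff_condLik K y r).comp (contDiff_const.prodMk contDiff_id)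

theorem norm_proj_itemParams_le (i : Fin 3 × Fin J) :
    ‖(EuclideanSpace.proj i : ItemParams J →L[ℝ] ℝ)‖ ≤ 1 :=
  ContinuousLinearMap.opNorm_le_bound _ zero_le_one fun v => by
    simpa using PiLp.norm_apply_le v i

/-- All factors lie in `[0, 1]`, so only the inner derivatives count, and these grow at most
linearly in `u`. A first moment of the latent law then suffices for domination. -/
theorem norm_fderiv_condLik_le (l : ItemParams J) (u : EuclideanSpace ℝ (Fin 2)) :
    ‖fderiv ℝ (fun l => condLik K l y r (u 0) (u 1)) l‖ ≤ J * (‖u‖ + 2 * ‖l‖ + 1) := by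
  have hp : ∀ i, HasFDerivAt (fun l : ItemParams J => l i)
      (EuclideanSpace.proj i : ItemParams J →L[ℝ] ℝ) l :=
    fun i => (EuclideanSpace.proj i : ItemParams J →L[ℝ] ℝ).hasFDerivAt
  have hpn := norm_proj_itemParams_le (J := J)
  have hli : ∀ i, ‖l i‖ ≤ ‖l‖ := PiLp.norm_apply_le l
  have hF : ∀ j, ‖fderiv ℝ (fun l : ItemParams J => bern (respProb K l (u 0) j) (y j)) l‖ ≤
      ‖u‖ + 2 * ‖l‖ := fun j => by
    refine (norm_fderiv_bern_link_le K.F (y j)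
      ((hp (0, j)).mul ((hp (1, j)).const_sub (u 0)))).trans ?_
    have h0 : ‖l (0, j) • -(EuclideanSpace.proj (1, j) : ItemParams J →L[ℝ] ℝ)‖ ≤ ‖l‖ := by
      rw [norm_smul, norm_neg]
      exact (mul_le_of_le_one_right (norm_nonneg _) (hpn _)).trans (hli _)
    have h1 : ‖(u 0 - l (1, j)) • (EuclideanSpace.proj (0, j) : ItemParams J →L[ℝ] ℝ)‖ ≤
        ‖u‖ + ‖l‖ := by
      rw [norm_smul]
      exact (mul_le_of_le_one_right (norm_nonneg _) (hpn _)).trans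
        ((norm_sub_le _ _).trans (add_le_add (PiLp.norm_apply_le u 0) (hli _)))
    exact (norm_add_le _ _).trans (by linarith)
  have hG : ∀ j, ‖fderiv ℝ (fun l : ItemParams J => bern (missProb K l (u 1) y r j) (r j)) l‖ ≤
      1 := fun j => by
    refine (norm_fderiv_bern_link_le K.G (r j)
      ((((hp (2, j)).const_add (K.γ₀ - u 1)).add_const _).add_const _)).trans (hpn _)
  have dF : ∀ j, DifferentiableAt ℝ (fun l : ItemParams J => bern (respProb K l (u 0) j) (y j)) l :=
    fun j => (ContDiff.bern (K.F.contDiff.comp ((contDiff_apply_itemParams (0, j)).mul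
      (contDiff_const.sub (contDiff_apply_itemParams (1, j))))) _).differentiable (by norm_num) _
  have dG : ∀ j, DifferentiableAt ℝ
      (fun l : ItemParams J => bern (missProb K l (u 1) y r j) (r j)) l :=
    fun j => (ContDiff.bern (K.G.contDiff.comp
      (((contDiff_const.add (contDiff_apply_itemParams (2, j))).add contDiff_const).add
        contDiff_const)) _).differentiable (by norm_num) _
  have bF : ∀ j, |bern (respProb K l (u 0) j) (y j)| ≤ 1 := fun j => by
    refine (abs_of_pos (bern_pos (K.F.toFun_pos _) (K.F.toFun_lt_one _) _)).le.trans ?_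
    exact bern_le_one (K.F.toFun_pos _) (K.F.toFun_lt_one _) _
  have bG : ∀ j, |bern (missProb K l (u 1) y r j) (r j)| ≤ 1 := fun j => by
    refine (abs_of_pos (bern_pos (K.G.toFun_pos _) (K.G.toFun_lt_one _) _)).le.trans ?_
    exact bern_le_one (K.G.toFun_pos _) (K.G.toFun_lt_one _) _
  have hfac : ∀ j, ‖fderiv ℝ (fun l : ItemParams J => bern (respProb K l (u 0) j) (y j) *
      bern (missProb K l (u 1) y r j) (r j)) l‖ ≤ ‖u‖ + 2 * ‖l‖ + 1 := fun j => by
    have h := ((dF j).hasFDerivAt.mul (dG j).hasFDerivAt).fderiv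
    refine (congrArg norm h).le.trans ?_
    refine (norm_add_le _ _).trans ?_
    rw [norm_smul, norm_smul, add_comm]
    exact add_le_add ((mul_le_of_le_one_left (norm_nonneg _) (bG j)).trans (hF j))
      ((mul_le_of_le_one_left (norm_nonneg _) (bF j)).trans (hG j))
  refine (norm_fderiv_prod_le Finset.univ (fun j _ => (dF j).mul (dG j)) fun j _ => ?_).trans ?_
  · refine (abs_mul _ _).le.trans ?_
    exact mul_le_one₀ (bF j) (abs_nonneg _) (bG j)
  · refine (Finset.sum_le_sum fun j _ => hfac j).trans ?_
    rw [Finset.sum_const, Finset.card_univ, Fintype.card_fin, nsmul_eq_mul]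

instance : IsProbabilityMeasure (latentLaw K) := by
  unfold latentLaw
  infer_instance

theorem integrable_condLik (l : ItemParams J) :
    Integrable (fun u => condLik K l y r (u 0) (u 1)) (latentLaw K) := by
  refine Integrable.of_bound (C := 1) ?_ (ae_of_all _ fun u => ?_)
  · exact ((contDiff_condLik K y r).continuous.comp
      (continuous_id.prodMk continuous_const)).aestronglyMeasurable
  · rw [Real.norm_of_nonneg (condLik_pos K y r l _ _).le]
    exact condLik_le_one K y r l _ _

theorem completeProb_pos (l : ItemParams J) : 0 < completeProb K l y r := by
  refine (integral_pos_iff_support_of_nonneg (fun u => (condLik_pos K y r l _ _).le)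
    (integrable_condLik K y r l)).2 ?_
  have : Function.support (fun u : EuclideanSpace ℝ (Fin 2) => condLik K l y r (u 0) (u 1)) =
      Set.univ := Set.eq_univ_of_forall fun u => (condLik_pos K y r l _ _).ne'
  simp [this]

/-- On a unit ball around `l₀` the derivative of the integrand has a majorant affine in `‖u‖`,
integrable under a Gaussian law. The same majorant serves for differentiating under the integral and
for continuity of the derivative. -/
theorem contDiff_completeProb : ContDiff ℝ 1 fun l : ItemParams J => completeProb K l y r := by
  have hbound : ∀ l₀ : ItemParams J, ∀ u : EuclideanSpace ℝ (Fin 2), ∀ l ∈ Metric.ball l₀ 1,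
      ‖fderiv ℝ (fun l => condLik K l y r (u 0) (u 1)) l‖ ≤ J * (‖u‖ + 2 * (‖l₀‖ + 1) + 1) := by
    intro l₀ u l hl
    refine (norm_fderiv_condLik_le K y r l u).trans ?_
    have : ‖l‖ ≤ ‖l₀‖ + 1 := by
      have h := norm_le_norm_add_norm_sub' l l₀
      rw [mem_ball_iff_norm] at hl
      linarith
    gcongr
  have hint : ∀ l₀ : ItemParams J, Integrable (fun u : EuclideanSpace ℝ (Fin 2) =>
      (J : ℝ) * (‖u‖ + 2 * (‖l₀‖ + 1) + 1)) (latentLaw K) := fun l₀ => by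
    have : Integrable (fun u : EuclideanSpace ℝ (Fin 2) => ‖u‖) (latentLaw K) := by
      unfold latentLaw
      exact IsGaussian.integrable_id.norm
    exact ((this.add (integrable_const _)).add (integrable_const _)).const_mul _
  have hmeas : ∀ l₀ : ItemParams J, AEStronglyMeasurable (fun u : EuclideanSpace ℝ (Fin 2) =>
      fderiv ℝ (fun l => condLik K l y r (u 0) (u 1)) l₀) (latentLaw K) := fun l₀ =>
    (measurable_fderiv_left (contDiff_condLik K y r).continuous l₀).aestronglyMeasurable
  have hder : ∀ l₀ : ItemParams J, HasFDerivAt (fun l : ItemParams J => completeProb K l y r)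
      (∫ u, fderiv ℝ (fun l => condLik K l y r (u 0) (u 1)) l₀ ∂latentLaw K) l₀ := fun l₀ =>
    hasFDerivAt_integral_of_dominated_of_fderiv_le (Metric.ball_mem_nhds l₀ one_pos)
      (Eventually.of_forall fun l => (integrable_condLik K y r l).aestronglyMeasurable)
      (integrable_condLik K y r l₀) (hmeas l₀)
      (ae_of_all _ (hbound l₀)) (hint l₀) (ae_of_all _ fun u l _ =>
        ((contDiff_condLik_right K y r u).differentiable (by norm_num) l).hasFDerivAt)
  refine contDiff_one_iff_fderiv.2 ⟨fun l => (hder l).differentiableAt, ?_⟩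
  rw [funext fun l => (hder l).fderiv]
  refine continuous_iff_continuousAt.2 fun l₀ => continuousAt_of_dominated
    (Eventually.of_forall hmeas)
    (eventually_of_mem (Metric.ball_mem_nhds l₀ one_pos) fun l hl =>
      ae_of_all _ fun u => hbound l₀ u l hl) (hint l₀) (ae_of_all _ fun u => ?_)
  exact ((contDiff_condLik_right K y r u).continuous_fderiv (by norm_num)).continuousAt

end

/-! ### Normalization, and coarsening of complete to observed data -/

/-- For fixed `y` the missingness indicators are sequential Bernoulli variables and sum out first;
the responses then sum out as independent ones. -/
theorem sum_condLik (K : Known) (l : ItemParams J) (θ τ : ℝ) :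
    ∑ y : Fin J → Bool, ∑ r : Fin J → Bool, condLik K l y r θ τ = 1 := by
  have hr : ∀ y : Fin J → Bool,
      ∑ r : Fin J → Bool, ∏ j, bern (missProb K l τ y r j) (r j) = 1 := fun y =>
    sum_prod_bern (fun j r => missProb K l τ y r j) fun j r r' h => by
      simp only [missProb]
      congr 4
      refine Finset.sum_congr rfl fun i _ => ?_
      split_ifs with hi
      · rw [h i hi.2]
      · rfl
  simp only [condLik, Finset.prod_mul_distrib, ← Finset.mul_sum, hr, mul_one]
  exact sum_prod_bern (fun j _ => respProb K l θ j) fun _ _ _ _ => rfl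

theorem sum_completeProb (K : Known) (l : ItemParams J) :
    ∑ y : Fin J → Bool, ∑ r : Fin J → Bool, completeProb K l y r = 1 := by
  simp only [completeProb]
  have : ∀ y : Fin J → Bool, ∑ r : Fin J → Bool, ∫ u, condLik K l y r (u 0) (u 1) ∂latentLaw K =
      ∫ u, ∑ r : Fin J → Bool, condLik K l y r (u 0) (u 1) ∂latentLaw K := fun y =>
    (integral_finsetSum _ fun r _ => integrable_condLik K y r l).symm
  rw [Finset.sum_congr rfl fun y _ => this y, ← integral_finsetSum _ fun y _ =>
    integrable_finsetSum _ fun r _ => integrable_condLik K y r l]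
  simp [sum_condLik]

open scoped RealInnerProductSpace

/-- Averaging a function of the cell `y` against the law `q` only involves the totals of the cells:
ratios of cell totals of `a` and `q` have the same integral as `a` itself. -/
theorem sum_mul_div_cell {X : Type*} [Fintype X] (s : X → X → Prop)
    [∀ x y, Decidable (s x y)] (hs : Equivalence s) (q a g : X → ℝ) (hq : ∀ x, 0 < q x)
    (hg : ∀ x y, s x y → g x = g y) :
    ∑ y, q y * (g y * ((∑ x, if s x y then a x else 0) / ∑ x, if s x y then q x else 0)) =
      ∑ x, g x * a x := by
  have hcell : ∀ x y, s x y → (∑ z, if s z y then q z else 0) = ∑ z, if s z x then q z else 0 :=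
    fun x y h => Finset.sum_congr rfl fun z _ =>
      if_congr ⟨fun hz => hs.trans hz (hs.symm h), fun hz => hs.trans hz h⟩ rfl rfl
  have hpos : ∀ x, 0 < ∑ z, if s z x then q z else 0 := fun x =>
    Finset.sum_pos' (fun z _ => by split_ifs <;> simp [(hq z).le])
      ⟨x, Finset.mem_univ x, by simp [hs.refl x, hq x]⟩
  simp only [Finset.sum_div, Finset.mul_sum]
  rw [Finset.sum_comm]
  refine Finset.sum_congr rfl fun x _ => ?_
  -- With `x` now in the outer sum, everything but `q y` depends only on the cell of `x`; summing `q
  -- y` over that cell cancels the denominator.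
  have hterm : ∀ y, q y * (g y * ((if s x y then a x else 0) / ∑ z, if s z y then q z else 0)) =
      g x * a x / (∑ z, if s z x then q z else 0) * if s y x then q y else 0 := fun y => by
    by_cases h : s x y
    · rw [if_pos h, if_pos (hs.symm h), hcell x y h, hg x y h]
      ring
    · rw [if_neg h, if_neg fun h' => h (hs.symm h')]
      ring
  rw [Finset.sum_congr rfl fun y _ => hterm y, ← Finset.mul_sum, div_mul_cancel₀ _ (hpos x).ne']

/-- Two response patterns agree on the observed items. -/
def AgreeOn (r y y' : Fin J → Bool) : Prop := ∀ j, r j = false → y j = y' j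

theorem equivalence_agreeOn (r : Fin J → Bool) : Equivalence (AgreeOn r) :=
  ⟨fun _ _ _ => rfl, fun h j hj => (h j hj).symm, fun h h' j hj => (h j hj).trans (h' j hj)⟩

/-! ### Observed likelihood, score and information identities -/

section

variable (K : Known)

open Classical in
theorem obsProb_eq_sum (l : ItemParams J) (y r : Fin J → Bool) :
    obsProb K l y r = ∑ y', if AgreeOn r y' y then completeProb K l y' r else 0 :=
  Finset.sum_congr rfl fun _ _ => if_congr Iff.rfl rfl rfl

theorem obsProb_congr {r y y' : Fin J → Bool} (h : AgreeOn r y y') (l : ItemParams J) :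
    obsProb K l y r = obsProb K l y' r := by
  classical
  rw [obsProb_eq_sum, obsProb_eq_sum]
  have hs := equivalence_agreeOn r
  exact Finset.sum_congr rfl fun z _ =>
    if_congr ⟨fun hz => hs.trans hz h, fun hz => hs.trans hz (hs.symm h)⟩ rfl rfl

theorem obsProb_pos (l : ItemParams J) (y r : Fin J → Bool) : 0 < obsProb K l y r := by
  classical
  rw [obsProb_eq_sum]
  exact Finset.sum_pos' (fun z _ => by split_ifs <;> simp [(completeProb_pos K z r l).le])
    ⟨y, Finset.mem_univ y, by simp [(equivalence_agreeOn r).refl y, completeProb_pos K y r l]⟩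

theorem contDiff_obsProb (y r : Fin J → Bool) :
    ContDiff ℝ 1 fun l : ItemParams J => obsProb K l y r := by
  classical
  simp only [obsProb_eq_sum]
  refine ContDiff.sum fun y' _ => ?_
  split_ifs
  · exact contDiff_completeProb K y' r
  · exact contDiff_const

open Classical in
theorem fderiv_obsProb (l v : ItemParams J) (y r : Fin J → Bool) :
    fderiv ℝ (fun l => obsProb K l y r) l v =
      ∑ y', if AgreeOn r y' y then fderiv ℝ (fun l => completeProb K l y' r) l v else 0 := by
  simp only [obsProb_eq_sum]
  have h : ∀ y' ∈ Finset.univ, HasFDerivAt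
      (fun l : ItemParams J => if AgreeOn r y' y then completeProb K l y' r else 0)
      (if AgreeOn r y' y then fderiv ℝ (fun l => completeProb K l y' r) l else 0) l := by
    intro y' _
    split_ifs
    · exact ((contDiff_completeProb K y' r).differentiable (by norm_num) l).hasFDerivAt
    · exact hasFDerivAt_const _ _
  rw [(HasFDerivAt.fun_sum h).fderiv, _root_.sum_apply]
  refine Finset.sum_congr rfl fun y' _ => ?_
  split_ifs <;> rfl

theorem contDiff_log_obsProb (y r : Fin J → Bool) :
    ContDiff ℝ 1 fun l : ItemParams J => Real.log (obsProb K l y r) :=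
  (contDiff_obsProb K y r).log fun l => (obsProb_pos K l y r).ne'

theorem fderiv_log_obsProb (l v : ItemParams J) (y r : Fin J → Bool) :
    fderiv ℝ (fun l => Real.log (obsProb K l y r)) l v =
      fderiv ℝ (fun l => obsProb K l y r) l v / obsProb K l y r := by
  have h := ((contDiff_obsProb K y r).differentiable (by norm_num) l).hasFDerivAt.log
    (obsProb_pos K l y r).ne'
  rw [h.fderiv, smul_apply, smul_eq_mul]
  ring

/-- The score of one examinee with complete data `x = (y, r)`, as a vector. -/
noncomputable def scoreVec (x : (Fin J → Bool) × (Fin J → Bool)) (l : ItemParams J) :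
    ItemParams J :=
  (InnerProductSpace.toDual ℝ (ItemParams J)).symm
    (fderiv ℝ (fun l => Real.log (obsProb K l x.1 x.2)) l)

theorem inner_scoreVec (x : (Fin J → Bool) × (Fin J → Bool)) (l v : ItemParams J) :
    ⟪scoreVec K x l, v⟫ = fderiv ℝ (fun l => Real.log (obsProb K l x.1 x.2)) l v :=
  InnerProductSpace.toDual_symm_apply

theorem continuous_scoreVec (x : (Fin J → Bool) × (Fin J → Bool)) :
    Continuous (scoreVec K x) :=
  (InnerProductSpace.toDual ℝ (ItemParams J)).symm.continuous.comp
    ((contDiff_log_obsProb K x.1 x.2).continuous_fderiv (by norm_num))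

/-- The observed score is a ratio of cell totals, derivative over probability, where a cell collects
the responses agreeing on the observed items. Against a weight constant on cells, `sum_mul_div_cell`
removes the ratio. The weight `1` gives mean zero, the score itself the information identity. -/
theorem sum_completeProb_mul_inner_scoreVec (l v : ItemParams J)
    (g : (Fin J → Bool) × (Fin J → Bool) → ℝ)
    (hg : ∀ r y y', AgreeOn r y y' → g (y, r) = g (y', r)) :
    ∑ x : (Fin J → Bool) × (Fin J → Bool),
        completeProb K l x.1 x.2 * (g x * ⟪scoreVec K x l, v⟫) =
      ∑ x, g x * fderiv ℝ (fun l => completeProb K l x.1 x.2) l v := by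
  classical
  rw [Fintype.sum_prod_type_right, Fintype.sum_prod_type_right]
  refine Finset.sum_congr rfl fun r _ => ?_
  rw [← sum_mul_div_cell (AgreeOn r) (equivalence_agreeOn r) (fun y => completeProb K l y r)
    (fun y => fderiv ℝ (fun l => completeProb K l y r) l v) (fun y => g (y, r))
    (fun y => completeProb_pos K y r l) (hg r)]
  refine Finset.sum_congr rfl fun y _ => ?_
  rw [inner_scoreVec, fderiv_log_obsProb, fderiv_obsProb, obsProb_eq_sum]

theorem sum_fderiv_completeProb (l v : ItemParams J) :
    ∑ x : (Fin J → Bool) × (Fin J → Bool), fderiv ℝ (fun l => completeProb K l x.1 x.2) l v = 0 := by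
  have h := HasFDerivAt.fun_sum (u := Finset.univ) (x := l)
    fun (x : (Fin J → Bool) × (Fin J → Bool)) _ =>
      ((contDiff_completeProb K x.1 x.2).differentiable (by norm_num) l).hasFDerivAt
  have hc : (fun l : ItemParams J => ∑ x : (Fin J → Bool) × (Fin J → Bool),
      completeProb K l x.1 x.2) = fun _ => 1 := funext fun l => by
    rw [Fintype.sum_prod_type, sum_completeProb]
  rw [hc] at h
  have h0 := congrArg (fun L : ItemParams J →L[ℝ] ℝ => L v) (h.unique (hasFDerivAt_const 1 l))
  simpa [_root_.sum_apply] using h0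

/-- The score has mean zero. -/
theorem sum_completeProb_smul_scoreVec (l : ItemParams J) :
    ∑ x : (Fin J → Bool) × (Fin J → Bool), completeProb K l x.1 x.2 • scoreVec K x l = 0 := by
  refine ext_inner_right ℝ fun v => ?_
  have h := sum_completeProb_mul_inner_scoreVec K l v (fun _ => 1) fun _ _ _ _ => rfl
  simp only [one_mul, sum_fderiv_completeProb] at h
  simpa [sum_inner, real_inner_smul_left] using h

theorem score_eq_inner (l : ItemParams J) (x : (Fin J → Bool) × (Fin J → Bool))
    (k : Fin 3 × Fin J) :
    score K l x.1 x.2 k = scoreVec K x l k := by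
  have h := inner_scoreVec K x l (EuclideanSpace.single k 1)
  rw [EuclideanSpace.inner_single_right] at h
  simpa [score] using h.symm

/-- The quadratic form of the Fisher information is the second moment of the score. -/
theorem sum_completeProb_mul_inner_mul_inner (l v w : ItemParams J) :
    ∑ x : (Fin J → Bool) × (Fin J → Bool),
        completeProb K l x.1 x.2 * (⟪scoreVec K x l, v⟫ * ⟪scoreVec K x l, w⟫) =
      v.ofLp ⬝ᵥ (fisherInfo K l).mulVec w.ofLp := by
  have hM : ∀ k m, fisherInfo K l k m = ∑ x : (Fin J → Bool) × (Fin J → Bool),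
      completeProb K l x.1 x.2 * (scoreVec K x l k * scoreVec K x l m) := fun k m => by
    rw [Fintype.sum_prod_type]
    simp only [fisherInfo, Matrix.of_apply, ← score_eq_inner]
  have hi : ∀ x (u : ItemParams J), ⟪scoreVec K x l, u⟫ = ∑ k, u k * scoreVec K x l k :=
    fun x u => by simp [PiLp.inner_apply]
  simp only [dotProduct, Matrix.mulVec, hM, hi, Finset.sum_mul, Finset.mul_sum]
  rw [Finset.sum_comm]
  conv_rhs => rw [Finset.sum_comm]
  refine Finset.sum_congr rfl fun k _ => ?_
  rw [Finset.sum_comm]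
  refine Finset.sum_congr rfl fun m _ => Finset.sum_congr rfl fun x _ => ?_
  ring

/-- This identifies the derivative of the linearized likelihood equation with the Fisher
information; the score is an admissible weight because it sees only the observed responses. -/
theorem sum_fderiv_mul_inner_scoreVec (l v w : ItemParams J) :
    ∑ x : (Fin J → Bool) × (Fin J → Bool),
        fderiv ℝ (fun l => completeProb K l x.1 x.2) l v * ⟪scoreVec K x l, w⟫ =
      v.ofLp ⬝ᵥ (fisherInfo K l).mulVec w.ofLp := by
  rw [← sum_completeProb_mul_inner_mul_inner]
  have h := sum_completeProb_mul_inner_scoreVec K l v (fun x => ⟪scoreVec K x l, w⟫)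
    fun r y y' h => by
      simp only [inner_scoreVec]
      simp only [obsProb_congr K h]
  simp only [mul_comm ⟪scoreVec K _ l, w⟫] at h
  exact h.symm

/-- An interior maximizer of the log-likelihood solves the likelihood equation. -/
theorem IsMML.sum_scoreVec_eq_zero {Θ : Set (ItemParams J)} {N : ℕ} {y r : ℕ → Fin J → Bool}
    {l : ItemParams J} (h : IsMML K Θ N y r l) (hl : l ∈ interior Θ) :
    ∑ i ∈ Finset.range N, scoreVec K (y i, r i) l = 0 := by
  have hmax : IsLocalMax (logLik K N y r) l := h.2.isLocalMax (mem_interior_iff_mem_nhds.1 hl)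
  have hd : HasFDerivAt (logLik K N y r)
      (∑ i ∈ Finset.range N, fderiv ℝ (fun l => Real.log (obsProb K l (y i) (r i))) l) l := by
    have : logLik K N y r =
        fun l => ∑ i ∈ Finset.range N, Real.log (obsProb K l (y i) (r i)) :=
      funext fun l => Real.log_prod fun i _ => (obsProb_pos K l (y i) (r i)).ne'
    rw [this]
    exact HasFDerivAt.fun_sum fun i _ =>
      ((contDiff_log_obsProb K (y i) (r i)).differentiable (by norm_num) l).hasFDerivAt
  have h0 := hmax.hasFDerivAt_eq_zero hd
  simp only [scoreVec]
  rw [← map_sum, h0, map_zero]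

end

/-! ### Deterministic linearization of the estimating equation -/

section

open Asymptotics

variable {E X : Type*} [NormedAddCommGroup E] [NormedSpace ℝ E] [Fintype X]

/-- The scalar factor vanishes at `l₀`, so the product rule needs only continuity of `A x` there. -/
theorem hasFDerivAt_sum_sub_smul {q : X → E → ℝ} {A : X → E → E} {l₀ : E}
    (hq : ∀ x, DifferentiableAt ℝ (q x) l₀) (hA : ∀ x, ContinuousAt (A x) l₀) :
    HasFDerivAt (fun l => ∑ x, (q x l - q x l₀) • A x l)
      (∑ x, (fderiv ℝ (q x) l₀).smulRight (A x l₀)) l₀ := by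
  refine HasFDerivAt.fun_sum fun x _ => ?_
  rw [hasFDerivAt_iff_isLittleO]
  have h1 : (fun l => (q x l - q x l₀ - fderiv ℝ (q x) l₀ (l - l₀)) • A x l) =o[𝓝 l₀]
      fun l => l - l₀ := by
    have := (hq x).hasFDerivAt.isLittleO.norm_right.smul_isBigO ((hA x).isBigO_one ℝ)
    simpa using this.norm_right
  have h2 : (fun l => fderiv ℝ (q x) l₀ (l - l₀) • (A x l - A x l₀)) =o[𝓝 l₀]
      fun l => l - l₀ := by
    have hb : (fun l => fderiv ℝ (q x) l₀ (l - l₀)) =O[𝓝 l₀] fun l => ‖l - l₀‖ :=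
      ((fderiv ℝ (q x) l₀).isBigO_comp _ _).norm_right
    have ho : (fun l => A x l - A x l₀) =o[𝓝 l₀] fun _ => (1 : ℝ) := by
      rw [isLittleO_one_iff]
      simpa using (hA x).sub_const (A x l₀)
    simpa using (hb.smul_isLittleO ho).norm_right
  refine (h1.add h2).congr_left fun l => ?_
  simp only [ContinuousLinearMap.smulRight_apply, sub_smul, smul_sub, sub_self, zero_smul]
  abel

/-- Solutions `l` near `l₀` of an estimating equation `∑ m x • A x l = 0` are, up to a small
multiple of the deviation of `m` from `c • q · l₀`, linear in `m`. -/
theorem eventually_norm_smul_sub_le {q : X → E → ℝ} {A : X → E → E} {l₀ : E}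
    (hq : ∀ x, DifferentiableAt ℝ (q x) l₀) (hA : ∀ x, ContinuousAt (A x) l₀)
    (h0 : ∀ l, ∑ x, q x l • A x l = 0) (S : E →L[ℝ] E)
    (hS : ∀ v, S (∑ x, fderiv ℝ (q x) l₀ v • A x l₀) = v) {η : ℝ} (hη : 0 < η) :
    ∀ᶠ l in 𝓝 l₀, ∀ (m : X → ℝ) (c : ℝ), 0 ≤ c → ∑ x, m x • A x l = 0 →
      ‖c • (l - l₀) - S (∑ x, m x • A x l₀)‖ ≤ η * ∑ x, |m x - c * q x l₀| := by
  set s := ‖S‖ with hs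
  set k := ∑ x, ‖A x l₀‖ with hk
  have hs0 : 0 ≤ s := norm_nonneg _
  have hk0 : 0 ≤ k := Finset.sum_nonneg fun _ _ => norm_nonneg _
  have hsk : 0 < 1 + s * k := by positivity
  -- Chosen so that `2 * (s * ε) * (1 + s * k) ≤ min 1 η`: the `1` allows absorbing `‖Δ‖` on the
  -- left at the end, the `η` gives the claimed constant. Using `s + 1` keeps the denominator
  -- positive if `s = 0`.
  set ε := min 1 η / (2 * (s + 1) * (1 + s * k)) with hε
  have hmin : 0 < min 1 η := lt_min one_pos hη
  have hε0 : 0 < ε := by positivity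
  have hsε : 2 * (s * ε) * (1 + s * k) ≤ min 1 η := by
    have : 2 * (s * ε) * (1 + s * k) = min 1 η * (s / (s + 1)) := by
      rw [hε]
      field_simp
    rw [this]
    exact mul_le_of_le_one_right hmin.le ((div_le_one (by positivity)).2 (by linarith))
  have hd := (hasFDerivAt_sum_sub_smul hq hA).isLittleO.def hε0
  have hc : ∀ᶠ l in 𝓝 l₀, ∀ x, ‖A x l - A x l₀‖ ≤ ε := eventually_all.2 fun x => by
    have := (hA x).eventually (Metric.closedBall_mem_nhds _ hε0)
    filter_upwards [this] with l hl
    simpa [dist_eq_norm] using hl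
  filter_upwards [hd, hc] with l hdl hcl m c hc0 hm
  set D := ∑ x, |m x - c * q x l₀| with hD
  have hD0 : 0 ≤ D := Finset.sum_nonneg fun _ _ => abs_nonneg _
  set T : E := ∑ x, fderiv ℝ (q x) l₀ (l - l₀) • A x l₀ with hT
  set h : E := ∑ x, (q x l - q x l₀) • A x l with hh
  have he : ‖h - T‖ ≤ ε * ‖l - l₀‖ := by
    simpa [hh, hT, _root_.sum_apply] using hdl
  have heq : c • h = ∑ x, (m x - c * q x l₀) • A x l := by
    have h1 := h0 l
    have : ∑ x, (m x - c * q x l₀) • A x l - c • h =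
        ∑ x, m x • A x l - c • ∑ x, q x l • A x l := by
      rw [hh, Finset.smul_sum, Finset.smul_sum, ← Finset.sum_sub_distrib, ← Finset.sum_sub_distrib]
      refine Finset.sum_congr rfl fun x _ => ?_
      module
    rw [hm, h1, smul_zero, sub_zero] at this
    exact (sub_eq_zero.1 this).symm
  have hm0 : ∑ x, m x • A x l₀ = ∑ x, (m x - c * q x l₀) • A x l₀ := by
    have : ∑ x, (m x - c * q x l₀) • A x l₀ =
        ∑ x, m x • A x l₀ - c • ∑ x, q x l₀ • A x l₀ := by
      rw [Finset.smul_sum, ← Finset.sum_sub_distrib]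
      refine Finset.sum_congr rfl fun x _ => ?_
      module
    rw [this, h0 l₀, smul_zero, sub_zero]
  set R : E := ∑ x, (m x - c * q x l₀) • (A x l - A x l₀) with hR
  have hRle : ‖R‖ ≤ ε * D := by
    rw [hD, Finset.mul_sum]
    refine (norm_sum_le _ _).trans (Finset.sum_le_sum fun x _ => ?_)
    rw [norm_smul, Real.norm_eq_abs, mul_comm]
    exact mul_le_mul_of_nonneg_right (hcl x) (abs_nonneg _)
  have hM : ‖∑ x, m x • A x l₀‖ ≤ k * D := by
    rw [hm0, hk, Finset.sum_mul]
    refine (norm_sum_le _ _).trans (Finset.sum_le_sum fun x _ => ?_)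
    rw [norm_smul, Real.norm_eq_abs, mul_comm]
    exact mul_le_mul_of_nonneg_left
      (Finset.single_le_sum (f := fun x => |m x - c * q x l₀|) (fun _ _ => abs_nonneg _)
        (Finset.mem_univ x)) (norm_nonneg _)
  set Δ : E := c • (l - l₀) - S (∑ x, m x • A x l₀) with hΔ
  -- The error splits into moving `A` from `l` to `l₀` (`R`) and linearizing `h` (`h - T`). The
  -- latter is bounded through `c • (l - l₀)`, hence through `‖Δ‖` itself.
  have hkey : Δ = S (R - c • (h - T)) := by
    have hRe : R = c • h - ∑ x, m x • A x l₀ := by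
      rw [hR, heq, hm0, ← Finset.sum_sub_distrib]
      exact Finset.sum_congr rfl fun x _ => smul_sub _ _ _
    have hST : S (c • T) = c • (l - l₀) := by rw [map_smul, hS]
    rw [hΔ, ← hST, ← map_sub, hRe]
    congr 1
    module
  have hδ : ‖c • (l - l₀)‖ ≤ ‖Δ‖ + s * (k * D) := by
    have : c • (l - l₀) = Δ + S (∑ x, m x • A x l₀) := by rw [hΔ]; abel
    rw [this]
    exact (norm_add_le _ _).trans (add_le_add_right
      ((S.le_opNorm _).trans (mul_le_mul_of_nonneg_left hM hs0)) _)
  have hΔle : ‖Δ‖ ≤ s * ε * D + s * ε * (‖Δ‖ + s * (k * D)) := by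
    calc ‖Δ‖ ≤ s * ‖R - c • (h - T)‖ := by rw [hkey]; exact S.le_opNorm _
      _ ≤ s * (ε * D + ε * (‖Δ‖ + s * (k * D))) := by
        refine mul_le_mul_of_nonneg_left ((norm_sub_le _ _).trans (add_le_add hRle ?_)) hs0
        rw [norm_smul]
        calc ‖c‖ * ‖h - T‖ ≤ ‖c‖ * (ε * ‖l - l₀‖) :=
              mul_le_mul_of_nonneg_left he (norm_nonneg _)
          _ = ε * ‖c • (l - l₀)‖ := by rw [norm_smul]; ring
          _ ≤ _ := mul_le_mul_of_nonneg_left hδ hε0.le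
      _ = _ := by ring
  have h1 : 2 * (s * ε) ≤ 1 := by
    refine le_trans ?_ (hsε.trans (min_le_left _ _))
    exact le_mul_of_one_le_right (by positivity) (by linarith [mul_nonneg hs0 hk0])
  have h2 : 2 * (s * ε) * (1 + s * k) * D ≤ η * D :=
    mul_le_mul_of_nonneg_right (hsε.trans (min_le_right _ _)) hD0
  nlinarith [norm_nonneg Δ, mul_le_mul_of_nonneg_right h1 (norm_nonneg Δ)]

end

/-! ### Central limit theorem and fluctuation of the counts -/

section

variable {Ω : Type*} [MeasurableSpace Ω] {μ : Measure Ω}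

/-- The Cramér–Wold device: it reduces the vector limit theorem to its one-dimensional projections.
-/
theorem charFun_map_eq_charFun_map_inner {E : Type*} [NormedAddCommGroup E] [InnerProductSpace ℝ E]
    [MeasurableSpace E] [BorelSpace E] [SecondCountableTopology E] {Z : Ω → E}
    (hZ : Measurable Z) (t : E) :
    charFun (μ.map Z) t = charFun (μ.map fun ω => ⟪Z ω, t⟫) 1 := by
  have hm : Measurable fun ω => ⟪Z ω, t⟫ := hZ.inner_const
  rw [charFun_apply, charFun_apply, integral_map hZ.aemeasurable (by fun_prop),
    integral_map hm.aemeasurable (by fun_prop)]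
  simp

variable [IsProbabilityMeasure μ]

/-- **Multivariate central limit theorem** for centered, independent and identically distributed
random vectors with covariance matrix `S`. -/
theorem tendstoInDistribution_inv_sqrt_smul_sum {ι : Type*} [Fintype ι] [DecidableEq ι]
    {W : ℕ → Ω → EuclideanSpace ℝ ι} {S : Matrix ι ι ℝ} (hS : S.PosSemidef)
    (hW : ∀ i, Measurable (W i)) (hindep : iIndepFun W μ)
    (hident : ∀ i, IdentDistrib (W i) (W 0) μ μ) (hmem : ∀ t, MemLp (fun ω => ⟪W 0 ω, t⟫) 2 μ)
    (hmean : ∀ t, ∫ ω, ⟪W 0 ω, t⟫ ∂μ = 0)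
    (hvar : ∀ t, ∫ ω, ⟪W 0 ω, t⟫ ^ 2 ∂μ = t.ofLp ⬝ᵥ S.mulVec t.ofLp) :
    TendstoInDistribution (fun (N : ℕ) ω => (Real.sqrt N)⁻¹ • ∑ i ∈ Finset.range N, W i ω) atTop id
      (fun _ => μ) (multivariateGaussian 0 S) where
  forall_aemeasurable N := by fun_prop
  tendsto := by
    refine ProbabilityMeasure.tendsto_iff_tendsto_charFun.2 fun t => ?_
    have hinner : Measurable fun v : EuclideanSpace ℝ ι => ⟪v, t⟫ := by fun_prop
    have hv : Var[fun ω => ⟪W 0 ω, t⟫; μ] = t.ofLp ⬝ᵥ S.mulVec t.ofLp := by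
      rw [variance_of_integral_eq_zero (X := fun ω => ⟪W 0 ω, t⟫)
        (hinner.comp (hW 0)).aemeasurable (hmean t), hvar]
    have hv0 : 0 ≤ Var[fun ω => ⟪W 0 ω, t⟫; μ] := variance_nonneg _ _
    have hclt := tendstoInDistribution_inv_sqrt_mul_sum_sub (P := μ)
      (P' := gaussianReal 0 Var[fun ω => ⟪W 0 ω, t⟫; μ].toNNReal) (Y := id)
      (X := fun i ω => ⟪W i ω, t⟫) HasLaw.id (hmem t)
      (hindep.comp (fun _ v => ⟪v, t⟫) fun _ => hinner) fun i => (hident i).comp hinner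
    have hcf := ProbabilityMeasure.tendsto_iff_tendsto_charFun.1 hclt.tendsto 1
    simp only [ProbabilityMeasure.coe_mk, Measure.map_id] at hcf ⊢
    have hlim : charFun (gaussianReal 0 Var[fun ω => ⟪W 0 ω, t⟫; μ].toNNReal) 1 =
        charFun (multivariateGaussian 0 S) t := by
      rw [charFun_gaussianReal, charFun_multivariateGaussian hS, hv, Real.coe_toNNReal _ (hv ▸ hv0)]
      simp
    rw [hlim] at hcf
    refine hcf.congr fun N => ?_
    rw [charFun_map_eq_charFun_map_inner (by fun_prop) t]
    congr 2
    funext ω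
    rw [hmean t, real_inner_smul_left, sum_inner]
    simp

/-- Empirical frequencies deviate from the probabilities by `O_P (1 / √N)`. -/
theorem measure_abs_count_sub_ge_le {X : Type*} [DecidableEq X] [MeasurableSpace X]
    [MeasurableSingletonClass X]
    {ξ : ℕ → Ω → X} (hξ : ∀ i, Measurable (ξ i)) (hindep : iIndepFun ξ μ) {x : X} {p : ℝ}
    (hlaw : ∀ i, μ.real {ω | ξ i ω = x} = p) {N : ℕ} (hN : N ≠ 0) {M : ℝ} (hM : 0 < M) :
    μ {ω | M * Real.sqrt N ≤ |(∑ i ∈ Finset.range N, if ξ i ω = x then (1 : ℝ) else 0) - N * p|} ≤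
      ENNReal.ofReal (1 / M ^ 2) := by
  have hg : Measurable fun z : X => if z = x then (1 : ℝ) else 0 :=
    Measurable.ite (measurableSet_singleton x) measurable_const measurable_const
  set f : ℕ → Ω → ℝ := fun i ω => if ξ i ω = x then (1 : ℝ) else 0 with hf
  have hfm : ∀ i, Measurable (f i) := fun i => hg.comp (hξ i)
  have hmem01 : ∀ i ω, f i ω ∈ Set.Icc (0 : ℝ) 1 := fun i ω => by
    simp only [hf]
    split_ifs <;> simp
  have hL : ∀ i, MemLp (f i) 2 μ := fun i =>
    MemLp.of_bound (hfm i).aestronglyMeasurable 1 (ae_of_all _ fun ω => by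
      rw [Real.norm_of_nonneg (hmem01 i ω).1]
      exact (hmem01 i ω).2)
  have hint : ∀ i, ∫ ω, f i ω ∂μ = p := fun i => by
    have hs : MeasurableSet {ω | ξ i ω = x} := hξ i (measurableSet_singleton x)
    have : f i = Set.indicator {ω | ξ i ω = x} 1 := by
      ext ω
      simp [hf, Set.indicator_apply]
    rw [this, integral_indicator_one hs, hlaw]
  have hind : iIndepFun f μ := hindep.comp (fun _ z => if z = x then (1 : ℝ) else 0) fun _ => hg
  have hvar : Var[∑ i ∈ Finset.range N, f i; μ] ≤ N := by
    rw [IndepFun.variance_sum (fun i _ => hL i) fun i _ j _ hij => hind.indepFun hij]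
    have hle : ∀ i, Var[f i; μ] ≤ 1 := fun i =>
      (variance_le_sq_of_bounded (a := 0) (b := 1) (ae_of_all _ (hmem01 i))
        (hfm i).aemeasurable).trans (by norm_num)
    refine (Finset.sum_le_sum fun i _ => hle i).trans ?_
    simp
  have hsum : ∫ ω, (∑ i ∈ Finset.range N, f i) ω ∂μ = N * p := by
    simp only [Finset.sum_apply]
    rw [integral_finsetSum _ fun i _ => (hL i).integrable (by norm_num)]
    simp [hint]
  have hsq : 0 < M * Real.sqrt N := by positivity
  have hcheb := meas_ge_le_variance_div_sq
    (memLp_finsetSum' (Finset.range N) fun i _ => hL i) hsq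
  rw [hsum] at hcheb
  simp only [Finset.sum_apply] at hcheb
  refine hcheb.trans (ENNReal.ofReal_le_ofReal ?_)
  have hN0 : (0 : ℝ) < N := by positivity
  rw [mul_pow, Real.sq_sqrt hN0.le, div_le_div_iff₀ (by positivity) (by positivity)]
  nlinarith [sq_nonneg M]

end

/-! ### Asymptotic normality for finitely valued observations -/

section

variable {Ω : Type*} [MeasurableSpace Ω] {μ : Measure Ω} [IsProbabilityMeasure μ]
  {X : Type*} [Fintype X]

theorem integral_comp_eq_sum [MeasurableSpace X] [MeasurableSingletonClass X]
    {ξ : Ω → X} (hξ : Measurable ξ) {p : X → ℝ}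
    (hlaw : ∀ x, μ.real {ω | ξ ω = x} = p x) (g : X → ℝ) :
    ∫ ω, g (ξ ω) ∂μ = ∑ x, p x * g x := by
  have : IsProbabilityMeasure (μ.map ξ) := Measure.isProbabilityMeasure_map hξ.aemeasurable
  rw [← integral_map (f := g) hξ.aemeasurable (measurable_of_finite g).aestronglyMeasurable,
    integral_fintype Integrable.of_finite]
  refine Finset.sum_congr rfl fun x _ => ?_
  rw [smul_eq_mul, map_measureReal_apply hξ (measurableSet_singleton x), ← hlaw]
  rfl

/-- Grouping by value puts the likelihood equation into the form treated by
`eventually_norm_smul_sub_le`. -/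
theorem sum_range_eq_sum_count_smul [DecidableEq X] {E : Type*} [AddCommGroup E] [Module ℝ E]
    (ξ : ℕ → X) (a : X → E) (N : ℕ) :
    ∑ i ∈ Finset.range N, a (ξ i) =
      ∑ x, (∑ i ∈ Finset.range N, if ξ i = x then (1 : ℝ) else 0) • a x := by
  simp only [Finset.sum_smul]
  rw [Finset.sum_comm]
  exact Finset.sum_congr rfl fun i _ => by simp

variable {ι : Type*} [Fintype ι] [DecidableEq ι]

/-- **Asymptotic normality** of consistent solutions of the likelihood equation, for independent
observations with finitely many values. Here `q x l` is the probability of the value `x` and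
`A x l` is the score. -/
theorem tendstoInDistribution_of_score_eq_zero [DecidableEq X] [MeasurableSpace X]
    [MeasurableSingletonClass X]
    {q : X → EuclideanSpace ℝ ι → ℝ} {A : X → EuclideanSpace ℝ ι → EuclideanSpace ℝ ι}
    {l₀ : EuclideanSpace ℝ ι} {M : Matrix ι ι ℝ} (hM : IsUnit M.det)
    (hq : ∀ x, DifferentiableAt ℝ (q x) l₀) (hA : ∀ x, ContinuousAt (A x) l₀)
    (hq0 : ∀ x, 0 ≤ q x l₀) (h0 : ∀ l, ∑ x, q x l • A x l = 0)
    (hder : ∀ v w : EuclideanSpace ℝ ι,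
      ∑ x, fderiv ℝ (q x) l₀ v * ⟪A x l₀, w⟫ = v.ofLp ⬝ᵥ M.mulVec w.ofLp)
    (hcov : ∀ v w : EuclideanSpace ℝ ι,
      ∑ x, q x l₀ * (⟪A x l₀, v⟫ * ⟪A x l₀, w⟫) = v.ofLp ⬝ᵥ M.mulVec w.ofLp)
    {ξ : ℕ → Ω → X} (hξ : ∀ i, Measurable (ξ i)) (hindep : iIndepFun ξ μ)
    (hlaw : ∀ i x, μ.real {ω | ξ i ω = x} = q x l₀)
    {est : ℕ → Ω → EuclideanSpace ℝ ι} (hmeas : ∀ N, Measurable (est N))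
    (hscore : Tendsto
      (fun N => μ {ω | ¬ ∑ i ∈ Finset.range N, A (ξ i ω) (est N ω) = 0}) atTop (𝓝 0))
    (hcons : TendstoInMeasure μ est atTop (fun _ => l₀)) :
    TendstoInDistribution (fun (N : ℕ) ω => Real.sqrt N • (est N ω - l₀)) atTop id
      (fun _ => μ) (multivariateGaussian 0 M⁻¹) := by
  have hsymm : ∀ v w : EuclideanSpace ℝ ι,
      v.ofLp ⬝ᵥ M.mulVec w.ofLp = w.ofLp ⬝ᵥ M.mulVec v.ofLp := fun v w => by
    rw [← hcov, ← hcov]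
    exact Finset.sum_congr rfl fun x _ => by ring
  have hMt : M.transpose = M := by
    ext i j
    have := hsymm (EuclideanSpace.single i 1) (EuclideanSpace.single j 1)
    simpa using this.symm
  have hpsd : M.PosSemidef := by
    refine Matrix.PosSemidef.of_dotProduct_mulVec_nonneg ?_ fun v => ?_
    · rw [Matrix.IsHermitian, Matrix.conjTranspose_eq_transpose_of_trivial, hMt]
    · have := hcov (WithLp.toLp 2 v) (WithLp.toLp 2 v)
      simp only [star_trivial]
      rw [← this]
      exact Finset.sum_nonneg fun x _ => mul_nonneg (hq0 x) (mul_self_nonneg _)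
  set S : EuclideanSpace ℝ ι →L[ℝ] EuclideanSpace ℝ ι := Matrix.toEuclideanCLM (𝕜 := ℝ) M⁻¹ with hS
  have hSapply : ∀ v, (S v).ofLp = M⁻¹.mulVec v.ofLp := fun v =>
    Matrix.ofLp_toEuclideanCLM (𝕜 := ℝ) M⁻¹ v
  have hSt : ∀ v w, ⟪S v, w⟫ = ⟪v, S w⟫ := fun v w => by
    have hsym : M⁻¹.transpose = M⁻¹ := by rw [Matrix.transpose_nonsing_inv, hMt]
    simp only [EuclideanSpace.inner_eq_star_dotProduct, star_trivial, hSapply]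
    rw [Matrix.dotProduct_mulVec, ← Matrix.mulVec_transpose, hsym]
  have hMS : ∀ v, M.mulVec (S v).ofLp = v.ofLp := fun v => by
    rw [hSapply, Matrix.mulVec_mulVec, Matrix.mul_nonsing_inv _ hM, Matrix.one_mulVec]
  have hST : ∀ v, S (∑ x, fderiv ℝ (q x) l₀ v • A x l₀) = v := fun v => by
    refine ext_inner_right ℝ fun w => ?_
    rw [hSt, sum_inner]
    simp only [real_inner_smul_left, hder, hMS]
    simp [EuclideanSpace.inner_eq_star_dotProduct, dotProduct_comm]
  have hid : ∀ i, IdentDistrib (ξ i) (ξ 0) μ μ := fun i =>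
    ⟨(hξ i).aemeasurable, (hξ 0).aemeasurable, by
      refine Measure.ext_of_singleton fun x => ?_
      rw [Measure.map_apply (hξ i) (measurableSet_singleton x),
        Measure.map_apply (hξ 0) (measurableSet_singleton x)]
      exact (measureReal_eq_measureReal_iff (by finiteness) (by finiteness)).1
        ((hlaw i x).trans (hlaw 0 x).symm)⟩
  -- The scores have covariance `M`, so their images under `S = M⁻¹` have covariance `M⁻¹ * M * M⁻¹
  -- = M⁻¹`.
  have hclt := tendstoInDistribution_inv_sqrt_smul_sum (μ := μ)
    (W := fun i ω => S (A (ξ i ω) l₀)) hpsd.inv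
    (fun i => (measurable_of_finite fun x => S (A x l₀)).comp (hξ i))
    (hindep.comp (fun _ x => S (A x l₀)) fun _ => measurable_of_finite _)
    (fun i => (hid i).comp (measurable_of_finite fun x => S (A x l₀)))
    (fun t => by
      refine MemLp.of_bound
        ((measurable_of_finite fun x => ⟪S (A x l₀), t⟫).comp (hξ 0)).aestronglyMeasurable
        (∑ x, ‖⟪S (A x l₀), t⟫‖) (ae_of_all _ fun ω => ?_)
      exact Finset.single_le_sum (f := fun x => ‖⟪S (A x l₀), t⟫‖) (fun _ _ => norm_nonneg _)
        (Finset.mem_univ (ξ 0 ω)))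
    (fun t => by
      rw [integral_comp_eq_sum (hξ 0) (hlaw 0) fun x => ⟪S (A x l₀), t⟫]
      have := congrArg (fun v => ⟪v, S t⟫) (h0 l₀)
      simpa [sum_inner, real_inner_smul_left, hSt] using this)
    (fun t => by
      rw [integral_comp_eq_sum (hξ 0) (hlaw 0) fun x => ⟪S (A x l₀), t⟫ ^ 2]
      simp only [hSt, pow_two, hcov, hMS]
      rw [hSapply, dotProduct_comm])
  -- Slutsky: it remains to show that the normalized estimator and the normalized score sum differ
  -- by `o_P(1)`.
  refine tendstoInDistribution_of_tendstoInMeasure_sub _ _ hclt ?_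
    fun N => (((hmeas N).sub_const l₀).const_smul (Real.sqrt N)).aemeasurable
  rw [tendstoInMeasure_iff_norm]
  intro ε hε
  simp only [Pi.sub_apply, Pi.zero_apply, sub_zero]
  rw [ENNReal.tendsto_nhds_zero]
  intro δ hδ
  have hδ3 : 0 < δ / 3 := ENNReal.div_pos hδ.ne' (by norm_num)
  set n : ℝ := (Fintype.card X : ℝ) with hn
  obtain ⟨b, hb0, hb⟩ : ∃ b : ℝ, 0 < b ∧ Fintype.card X * ENNReal.ofReal (1 / b ^ 2) ≤ δ / 3 := by
    have hlim : Tendsto (fun b : ℝ => Fintype.card X * ENNReal.ofReal (1 / b ^ 2)) atTop (𝓝 0) := by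
      have h1 : Tendsto (fun b : ℝ => 1 / b ^ 2) atTop (𝓝 0) :=
        tendsto_const_nhds.div_atTop (tendsto_pow_atTop two_ne_zero)
      have h2 := ENNReal.tendsto_ofReal h1
      rw [ENNReal.ofReal_zero] at h2
      simpa using ENNReal.Tendsto.const_mul h2 (Or.inr (ENNReal.natCast_ne_top (Fintype.card X)))
    exact ((eventually_gt_atTop 0).and (hlim.eventually_le_const hδ3)).exists
  -- If each count deviates by less than `b * √N`, the linearization error divided by `√N` is at
  -- most `η * (n * b)`, which is below `ε`.
  set η : ℝ := ε / (2 * (n * b + 1)) with hη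
  have hn0 : 0 ≤ n := Nat.cast_nonneg _
  have hη0 : 0 < η := by positivity
  obtain ⟨ρ, hρ0, hρ⟩ := Metric.eventually_nhds_iff.1
    (eventually_norm_smul_sub_le hq hA h0 S hST hη0)
  have hc := ENNReal.tendsto_nhds_zero.1 (tendstoInMeasure_iff_norm.1 hcons ρ hρ0) _ hδ3
  have hs := ENNReal.tendsto_nhds_zero.1 hscore _ hδ3
  filter_upwards [hc, hs, eventually_ne_atTop 0] with N hcN hsN hN
  -- A large difference forces one of three events, each of probability at most `δ / 3`: the
  -- estimator is far from `l₀`, the score equation fails, or some count deviates too much.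
  have hsub : {ω | ε ≤ ‖Real.sqrt N • (est N ω - l₀) -
        (Real.sqrt N)⁻¹ • ∑ i ∈ Finset.range N, S (A (ξ i ω) l₀)‖} ⊆
      ({ω | ρ ≤ ‖est N ω - l₀‖} ∪ {ω | ¬ ∑ i ∈ Finset.range N, A (ξ i ω) (est N ω) = 0}) ∪
        ⋃ x, {ω | b * Real.sqrt N ≤
          |(∑ i ∈ Finset.range N, if ξ i ω = x then (1 : ℝ) else 0) - N * q x l₀|} := by
    intro ω hω
    by_contra hcon
    simp only [Set.mem_union, Set.mem_iUnion, Set.mem_ofPred_eq, not_or, not_exists, not_le,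
      not_not] at hcon hω
    obtain ⟨⟨hclose, hzero⟩, hdev⟩ := hcon
    have hN0 : (0 : ℝ) < N := by positivity
    have hsN0 : 0 < Real.sqrt N := Real.sqrt_pos.2 hN0
    rw [sum_range_eq_sum_count_smul (fun i => ξ i ω) (fun x => A x (est N ω))] at hzero
    have hkey := hρ (by rwa [dist_eq_norm]) _ N hN0.le hzero
    rw [← sum_range_eq_sum_count_smul (fun i => ξ i ω) (fun x => A x l₀), map_sum] at hkey
    have hD : ∑ x, |(∑ i ∈ Finset.range N, if ξ i ω = x then (1 : ℝ) else 0) - N * q x l₀| ≤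
        n * (b * Real.sqrt N) := by
      refine (Finset.sum_le_sum fun x _ => (hdev x).le).trans ?_
      simp [hn]
    have hfac : Real.sqrt N • (est N ω - l₀) -
        (Real.sqrt N)⁻¹ • ∑ i ∈ Finset.range N, S (A (ξ i ω) l₀) =
        (Real.sqrt N)⁻¹ • ((N : ℝ) • (est N ω - l₀) -
          ∑ i ∈ Finset.range N, S (A (ξ i ω) l₀)) := by
      have hsq : (Real.sqrt N)⁻¹ * N = Real.sqrt N := by
        rw [inv_mul_eq_div, Real.div_sqrt]
      rw [smul_sub (Real.sqrt N)⁻¹, smul_smul, hsq]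
    rw [hfac, norm_smul, Real.norm_of_nonneg (inv_nonneg.2 hsN0.le)] at hω
    have h1 : ε ≤ (Real.sqrt N)⁻¹ * (η * (n * (b * Real.sqrt N))) :=
      hω.trans (mul_le_mul_of_nonneg_left
        (hkey.trans (mul_le_mul_of_nonneg_left hD hη0.le)) (inv_nonneg.2 hsN0.le))
    have h2 : (Real.sqrt N)⁻¹ * (η * (n * (b * Real.sqrt N))) = η * (n * b) := by
      field_simp
    have h3 : η * (2 * (n * b + 1)) = ε := by
      rw [hη]
      field_simp
    rw [h2] at h1
    nlinarith [mul_nonneg hn0 hb0.le]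
  calc _ ≤ _ := measure_mono hsub
    _ ≤ (δ / 3 + δ / 3) + δ / 3 := by
      refine (measure_union_le _ _).trans (add_le_add ((measure_union_le _ _).trans
        (add_le_add hcN hsN)) ((measure_iUnion_fintype_le _ _).trans ?_))
      refine (Finset.sum_le_sum fun x _ =>
        measure_abs_count_sub_ge_le hξ hindep (fun i => hlaw i x) hN hb0).trans ?_
      simpa using hb
    _ = δ := ENNReal.add_thirds δ

end

end MissingIRT

/-! ### Application to the missing-data model -/

open MissingIRT in
theorem theorem2 {J : ℕ} (K : Known) (hK : (latentCov K).PosDef)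
    (Θ : Set (ItemParams J)) (hΘ : Θ ⊆ paramSpace J)
    (l₀ : ItemParams J) (hl₀ : l₀ ∈ interior Θ)
    (hI : IsUnit (fisherInfo K l₀).det)
    {Ω : Type*} [MeasurableSpace Ω] (μ : Measure Ω) [IsProbabilityMeasure μ]
    (Y R : ℕ → Ω → Fin J → Bool) (hYR : IsSample μ K l₀ Y R)
    (est : ℕ → Ω → ItemParams J) (hmeas : ∀ N, Measurable (est N))
    (hmml : Tendsto
      (fun N => μ {ω | ¬ IsMML K Θ N (fun i => Y i ω) (fun i => R i ω) (est N ω)})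
      atTop (𝓝 0))
    (hcons : TendstoInMeasure μ est atTop (fun _ => l₀)) :
    TendstoInDistribution (fun (N : ℕ) ω => Real.sqrt N • (est N ω - l₀)) atTop id
      (fun _ => μ) (multivariateGaussian 0 (fisherInfo K l₀)⁻¹) := by
  -- The observations are taken to be the complete patterns, whose law is given; incompleteness
  -- enters only through the score, which is that of the observed data.
  refine tendstoInDistribution_of_score_eq_zero (X := (Fin J → Bool) × (Fin J → Bool))
    (q := fun x l => completeProb K l x.1 x.2) (A := scoreVec K)
    (ξ := fun i ω => (Y i ω, R i ω)) hI
    (fun x => (contDiff_completeProb K x.1 x.2).differentiable (by norm_num) l₀)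
    (fun x => (continuous_scoreVec K x).continuousAt)
    (fun x => (completeProb_pos K x.1 x.2 l₀).le)
    (sum_completeProb_smul_scoreVec K) (sum_fderiv_mul_inner_scoreVec K l₀)
    (sum_completeProb_mul_inner_mul_inner K l₀)
    (fun i => (hYR.measurable_Y i).prodMk (hYR.measurable_R i)) hYR.indep
    (fun i x => ?_) hmeas ?_ hcons
  · have hset : {ω | (Y i ω, R i ω) = x} = {ω | Y i ω = x.1 ∧ R i ω = x.2} := by
      ext ω
      exact Prod.ext_iff
    rw [hset, measureReal_def, hYR.law, ENNReal.toReal_ofReal (completeProb_pos K x.1 x.2 l₀).le]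
  -- By consistency the estimate lies in a ball inside `interior Θ` with probability tending to one,
  -- and there a maximizer is a critical point.
  · obtain ⟨ρ, hρ0, hρ⟩ := Metric.isOpen_iff.1 isOpen_interior l₀ hl₀
    have hlim := hmml.add (tendstoInMeasure_iff_norm.1 hcons ρ hρ0)
    rw [add_zero] at hlim
    refine tendsto_of_tendsto_of_tendsto_of_le_of_le tendsto_const_nhds hlim
      (fun _ => zero_le) fun N => ?_
    refine (measure_mono fun ω hω => ?_).trans (measure_union_le _ _)
    by_contra hcon
    simp only [Set.mem_union, Set.mem_ofPred_eq, not_or, not_not, not_le] at hcon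
    exact hω (IsMML.sum_scoreVec_eq_zero K hcon.1 (hρ (mem_ball_iff_norm.2 hcon.2)))
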